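/- Let $X$ be a completely regular Hausdorff space and $C(X)$ the ring of real-valued continuous functions on $X$. Write $Z(f)=\{x\in X: f(x)=0\}$ and, for an ideal $I$ of $C(X)$ (the improper ideal is allowed), $Z[I]=\{Z(h):h\in I\}$. The ideal $I$ is a $Z$-ideal if $Z(f)\in Z[I]$ implies $f\in I$; let $\mathcal I$ be the set of all $Z$-ideals of $C(X)$, ordered by inclusion. For $I\in\mathcal I$, the $U_I$-topology on $C(X)$ has as open base the sets $$U_I(f,\varepsilon)=\{g\in C(X):\ \sup_{x\in Z}|f(x)-g(x)|<\varepsilon\ \text{ for some } Z\in Z[I]\},\qquad f\in C(X),\ \varepsilon>0,$$ and the $m_I$-topology on $C(X)$ has as open base the sets $$m_I(f,u)=\{g\in C(X):\ |f(x)-g(x)|<u(x)\ \text{ for all } x\in Z,\ \text{ for some } Z\in Z[I]\},$$ where $f,u\in C(X)$ and $u$ is strictly positive on some $Z_0\in Z[I]$. For $I,J\in\mathcal I$ write $I\sim J$ if the $U_I$- and $U_J$-topologies are equal, and $I\approx J$ if the $m_I$- and $m_J$-topologies are equal; let $[I]$ and $[[I]]$ denote the equivalence classes of $I$ in $\mathcal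 I$ under $\sim$ and $\approx$, respectively. For $p\in\beta X$ (the Stone–Čech compactification of $X$) let $$M^p=\{f\in C(X): p\in \mathrm{cl}_{\beta X}Z(f)\},\qquad O^p=\{f\in C(X): \mathrm{cl}_{\beta X}Z(f)\text{ is a neighbourhood of } p \text{ in } \beta X\},$$ and for $A\subseteq\beta X$ let $M^A=\bigcap_{p\in A}M^p$, $O^A=\bigcap_{p\in A}O^p$ (so $M^\emptyset=O^\emptyset=C(X)$). These are $Z$-ideals. Then: 1. For every $A\subseteq\beta X$, with closure $\overline A=\mathrm{cl}_{\beta X}A$, $$[M^A]=[[M^A]]=\{I\in\mathcal I:\ O^{\overline A}\subseteq I\subseteq M^A\}.$$ 2. For every $I\in\mathcal I$, the class $[I]$ has a smallest and a largest member. 3. For every $I\in\mathcal I$, the class $[[I]]$ has a smallest and a largest member. 4. For every $I\in\mathcal I$, $[I]=[[I]]$; that is, $\sim$ and $\approx$ are the same relation on $\mathcal I$. -/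

import Mathlib

open Topology

namespace ZIdealTop

variable {X : Type*} [TopologicalSpace X]

/-- The zero set `Z(f) = {x | f x = 0}` of a continuous real-valued function. -/
def zeroSet (f : C(X, ℝ)) : Set X := {x | f x = 0}

/-- The family `Z[I]` of the zero sets of the members of an ideal. -/
def zeroSets (I : Ideal C(X, ℝ)) : Set (Set X) := {Z | ∃ h ∈ I, zeroSet h = Z}

/-- An ideal `I` of `C(X)` is a Z-ideal if `Z(f) ∈ Z[I]` implies `f ∈ I`. -/
def IsZIdeal (I : Ideal C(X, ℝ)) : Prop := ∀ f : C(X, ℝ), zeroSet f ∈ zeroSets I → f ∈ I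

variable (X) in
/-- The set of all Z-ideals of `C(X)`, ordered by inclusion. -/
abbrev ZIdeal : Type _ := {I : Ideal C(X, ℝ) // IsZIdeal I}

/-- The basic set `U_I(f, ε)`: all `g` with `sup_{x ∈ Z} |f x - g x| < ε` for some `Z ∈ Z[I]`.
The supremum is taken in the extended reals. -/
def uBasic (I : Ideal C(X, ℝ)) (f : C(X, ℝ)) (ε : ℝ) : Set C(X, ℝ) :=
  {g | ∃ Z ∈ zeroSets I, (⨆ x ∈ Z, ((|f x - g x| : ℝ) : EReal)) < (ε : EReal)}

/-- The `U_I`-topology on `C(X)`. -/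
abbrev uTopology (I : Ideal C(X, ℝ)) : TopologicalSpace C(X, ℝ) :=
  TopologicalSpace.generateFrom {S | ∃ (f : C(X, ℝ)) (ε : ℝ), 0 < ε ∧ S = uBasic I f ε}

/-- The basic set `m_I(f, u)`: all `g` with `|f - g| < u` on some `Z ∈ Z[I]`. -/
def mBasic (I : Ideal C(X, ℝ)) (f u : C(X, ℝ)) : Set C(X, ℝ) :=
  {g | ∃ Z ∈ zeroSets I, ∀ x ∈ Z, |f x - g x| < u x}

/-- The `m_I`-topology on `C(X)`, with base the sets `m_I(f, u)` where `u ∈ C(X)` is strictly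
positive on some `Z₀ ∈ Z[I]`. -/
abbrev mTopology (I : Ideal C(X, ℝ)) : TopologicalSpace C(X, ℝ) :=
  TopologicalSpace.generateFrom
    {S | ∃ f u : C(X, ℝ), (∃ Z₀ ∈ zeroSets I, ∀ x ∈ Z₀, 0 < u x) ∧ S = mBasic I f u}

variable (X) in
/-- The relation `I ∼ J`: the `U_I`- and `U_J`-topologies coincide. -/
def uSetoid : Setoid (ZIdeal X) where
  r I J := uTopology I.1 = uTopology J.1
  iseqv := ⟨fun _ => rfl, fun h => h.symm, fun h k => h.trans k⟩

variable (X) in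
/-- The relation `I ≈ J`: the `m_I`- and `m_J`-topologies coincide. -/
def mSetoid : Setoid (ZIdeal X) where
  r I J := mTopology I.1 = mTopology J.1
  iseqv := ⟨fun _ => rfl, fun h => h.symm, fun h k => h.trans k⟩

/-- The class `[I]` of a Z-ideal under `∼`. -/
def uClass (I : ZIdeal X) : Set (ZIdeal X) := {J | uSetoid X I J}

/-- The class `[[I]]` of a Z-ideal under `≈`. -/
def mClass (I : ZIdeal X) : Set (ZIdeal X) := {J | mSetoid X I J}

/-- The closure `cl_{βX} Z(f)` of the zero set of `f` in the Stone–Čech compactification. -/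
def clZ (f : C(X, ℝ)) : Set (StoneCech X) := closure (stoneCechUnit '' zeroSet f)

lemma clZ_mono {f g : C(X, ℝ)} (h : zeroSet f ⊆ zeroSet g) : clZ f ⊆ clZ g :=
  closure_mono (Set.image_mono h)

lemma zeroSet_mul_subset (c f : C(X, ℝ)) : zeroSet f ⊆ zeroSet (c * f) := by
  intro x hx
  have : f x = 0 := hx
  simp [zeroSet, this]

lemma clZ_zero : clZ (0 : C(X, ℝ)) = Set.univ := by
  have : zeroSet (0 : C(X, ℝ)) = Set.univ := by ext; simp [zeroSet]
  rw [clZ, this, Set.image_univ]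
  exact denseRange_stoneCechUnit.closure_range

/-- Functions with disjoint zero sets have disjoint closures of zero sets in `βX`. -/
lemma disjoint_clZ {f g : C(X, ℝ)} (h : ∀ x, ¬ (f x = 0 ∧ g x = 0)) (p : StoneCech X)
    (hf : p ∈ clZ f) (hg : p ∈ clZ g) : False := by
  have hpos : ∀ x, 0 < f x ^ 2 + g x ^ 2 := by
    intro x
    by_cases h0 : f x = 0
    · have : g x ≠ 0 := fun h1 => h x ⟨h0, h1⟩
      positivity
    · positivity
  let q : X → unitInterval := fun x => ⟨f x ^ 2 / (f x ^ 2 + g x ^ 2), by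
    have := hpos x
    refine ⟨by positivity, ?_⟩
    rw [div_le_one this]
    nlinarith [sq_nonneg (g x)]⟩
  have hq : Continuous q := by
    refine Continuous.subtype_mk ?_ _
    exact Continuous.div (by fun_prop) (by fun_prop) fun x => (hpos x).ne'
  have hE := continuous_stoneCechExtend hq
  have h0 : stoneCechExtend hq p = 0 := by
    have : clZ f ⊆ (stoneCechExtend hq) ⁻¹' {0} := by
      refine closure_minimal ?_ (isClosed_singleton.preimage hE)
      rintro _ ⟨x, hx, rfl⟩
      have hx' : f x = 0 := hx
      simp only [Set.mem_preimage, stoneCechExtend_stoneCechUnit, Set.mem_singleton_iff]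
      ext
      simp [q, hx']
    exact this hf
  have h1 : stoneCechExtend hq p = 1 := by
    have : clZ g ⊆ (stoneCechExtend hq) ⁻¹' {1} := by
      refine closure_minimal ?_ (isClosed_singleton.preimage hE)
      rintro _ ⟨x, hx, rfl⟩
      have hx' : g x = 0 := hx
      have hx2 := hpos x
      simp only [Set.mem_preimage, stoneCechExtend_stoneCechUnit, Set.mem_singleton_iff]
      ext
      simp only [q, hx'] at hx2 ⊢
      simpa using div_self hx2.ne'
    exact this hg
  rw [h0] at h1
  exact zero_ne_one h1

/-- `cl Z(f) ∩ cl Z(g) ⊆ cl Z(f + g)` in `βX`. -/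
lemma clZ_inter_subset (f g : C(X, ℝ)) : clZ f ∩ clZ g ⊆ clZ (f + g) := by
  rintro p ⟨hf, hg⟩
  by_contra hp
  obtain ⟨φ, hφ0, hφ1, -⟩ := exists_continuous_zero_one_of_isClosed
    (isClosed_singleton (x := p)) (isClosed_closure : IsClosed (clZ (f + g)))
    (Set.disjoint_singleton_left.2 hp)
  have hφp : φ p = 0 := hφ0 rfl
  let k : C(X, ℝ) := ⟨fun x => max (φ (stoneCechUnit x) - 1 / 2) 0, by
    have := continuous_stoneCechUnit (α := X)
    fun_prop⟩
  have key : ∀ e : C(X, ℝ), p ∈ clZ e → p ∈ clZ (e ^ 2 + k) := by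
    intro e he
    have hU : IsOpen {y : StoneCech X | φ y < 1 / 2} := isOpen_lt (by fun_prop) (by fun_prop)
    have hpU : p ∈ {y : StoneCech X | φ y < 1 / 2} := by
      simp only [Set.mem_ofPred_eq, hφp]
      norm_num
    have := hU.inter_closure ⟨hpU, he⟩
    refine closure_mono ?_ this
    rintro _ ⟨hy, x, hx, rfl⟩
    refine ⟨x, ?_, rfl⟩
    have hx' : e x = 0 := hx
    have hy' : φ (stoneCechUnit x) < 1 / 2 := hy
    have : φ (stoneCechUnit x) - 1 / 2 ≤ 0 := by linarith
    simp only [zeroSet, k, Set.mem_ofPred_eq, ContinuousMap.add_apply, ContinuousMap.pow_apply,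
      ContinuousMap.coe_mk, hx', max_eq_right this]
    norm_num
  refine disjoint_clZ ?_ p (key f hf) (key g hg)
  rintro x ⟨h1, h2⟩
  have hk : 0 ≤ k x := le_max_right _ _
  simp only [ContinuousMap.add_apply, ContinuousMap.pow_apply] at h1 h2
  have hfx : f x = 0 := by
    have := sq_nonneg (f x)
    exact pow_eq_zero_iff (two_ne_zero) |>.1 (by linarith)
  have hgx : g x = 0 := by
    have := sq_nonneg (g x)
    exact pow_eq_zero_iff (two_ne_zero) |>.1 (by linarith)
  have hkx : k x = 0 := by
    rw [hfx] at h1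
    simpa using h1
  have hmem : (stoneCechUnit x : StoneCech X) ∈ clZ (f + g) :=
    subset_closure ⟨x, by simp [zeroSet, hfx, hgx], rfl⟩
  have h1' : φ (stoneCechUnit x) = 1 := hφ1 hmem
  have : φ (stoneCechUnit x) - 1 / 2 ≤ k x := le_max_left _ _
  rw [h1', hkx] at this
  norm_num at this

/-- The ideal `M^p = {f | p ∈ cl_{βX} Z(f)}`, for `p ∈ βX`. -/
def mPoint (p : StoneCech X) : Ideal C(X, ℝ) where
  carrier := {f | p ∈ clZ f}
  zero_mem' := by simp [clZ_zero]
  add_mem' {f g} hf hg := clZ_inter_subset f g ⟨hf, hg⟩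
  smul_mem' c f hf := clZ_mono (zeroSet_mul_subset c f) hf

/-- The ideal `O^p = {f | cl_{βX} Z(f) is a neighbourhood of p}`, for `p ∈ βX`. -/
def oPoint (p : StoneCech X) : Ideal C(X, ℝ) where
  carrier := {f | clZ f ∈ 𝓝 p}
  zero_mem' := by simp [clZ_zero]
  add_mem' {f g} hf hg := Filter.mem_of_superset (Filter.inter_mem hf hg) (clZ_inter_subset f g)
  smul_mem' c f hf := Filter.mem_of_superset hf (clZ_mono (zeroSet_mul_subset c f))

/-- The Z-ideal `M^A = ⋂_{p ∈ A} M^p`; for empty `A` this is all of `C(X)`. -/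
def mSet (A : Set (StoneCech X)) : ZIdeal X :=
  ⟨⨅ p ∈ A, mPoint p, by
    rintro f ⟨h, hh, hZ⟩
    simp only [Submodule.mem_iInf] at hh ⊢
    exact fun p hp => clZ_mono hZ.le (hh p hp)⟩

/-- The Z-ideal `O^A = ⋂_{p ∈ A} O^p`; for empty `A` this is all of `C(X)`. -/
def oSet (A : Set (StoneCech X)) : ZIdeal X :=
  ⟨⨅ p ∈ A, oPoint p, by
    rintro f ⟨h, hh, hZ⟩
    simp only [Submodule.mem_iInf] at hh ⊢
    exact fun p hp => Filter.mem_of_superset (hh p hp) (clZ_mono hZ.le)⟩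

end ZIdealTop

open ZIdealTop

namespace ZIdealTop

variable {X : Type*} [TopologicalSpace X]

/-! Everything is governed by the closed set `hull I`, the intersection of the `clZ h` for `h ∈ I`.
A Z-ideal has hull `K`, for `K` closed, exactly when it lies between `oSet K` and `mSet K`
(`hull_eq_closure_iff`). Each of the two topologies determines the hull and is determined by it.
Given the hull, a function positive on a member of `Z[I]` is positive on the zero set of some
element of `oSet (hull I)`, which lies in every Z-ideal with that hull, so the basic sets agree
(`exists_mem_oSet_hull_pos`). Conversely, open sets are unions of cosets of `I`, so a
`J`-neighbourhood of 0 that is `I`-open contains `I`, which forces `hull J ⊆ hull I`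
(`hull_subset_hull_of_forall_lt`). -/

lemma mem_mSet {A : Set (StoneCech X)} {f : C(X, ℝ)} :
    f ∈ (mSet A).1 ↔ ∀ p ∈ A, p ∈ clZ f := by
  simp only [mSet, Submodule.mem_iInf]
  rfl

lemma mem_oSet {A : Set (StoneCech X)} {f : C(X, ℝ)} :
    f ∈ (oSet A).1 ↔ ∀ p ∈ A, clZ f ∈ 𝓝 p := by
  simp only [oSet, Submodule.mem_iInf]
  rfl

/-! ### Hulls, and the ideals with a given hull -/

/-- The closed subset `⋂_{h ∈ I} cl_{βX} Z(h)` of `βX` attached to an ideal `I`. -/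
def hull (I : Ideal C(X, ℝ)) : Set (StoneCech X) := ⋂ h : I, clZ h.1

lemma isClosed_hull (I : Ideal C(X, ℝ)) : IsClosed (hull I) :=
  isClosed_iInter fun _ => isClosed_closure

lemma hull_subset {I : Ideal C(X, ℝ)} {h : C(X, ℝ)} (hh : h ∈ I) : hull I ⊆ clZ h :=
  Set.iInter_subset (fun h : I => clZ h.1) ⟨h, hh⟩

lemma hull_anti {I J : Ideal C(X, ℝ)} (h : I ≤ J) : hull J ⊆ hull I :=
  Set.subset_iInter fun f => hull_subset (h f.2)

lemma zeroSet_sq_add_sq (f g : C(X, ℝ)) :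
    zeroSet (f * f + g * g) = zeroSet f ∩ zeroSet g := by
  ext x
  exact mul_self_add_mul_self_eq_zero

lemma inter_mem_zeroSets {I : Ideal C(X, ℝ)} {Y Z : Set X} (hY : Y ∈ zeroSets I)
    (hZ : Z ∈ zeroSets I) : Y ∩ Z ∈ zeroSets I := by
  obtain ⟨f, hf, rfl⟩ := hY
  obtain ⟨g, hg, rfl⟩ := hZ
  exact ⟨_, I.add_mem (I.mul_mem_left f hf) (I.mul_mem_left g hg), zeroSet_sq_add_sq f g⟩

lemma mem_zeroSet_of_unit_mem_clZ {f : C(X, ℝ)} {x : X} (h : stoneCechUnit x ∈ clZ f) :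
    x ∈ zeroSet f := by
  by_contra hx
  have hx' : f x ≠ 0 := hx
  refine disjoint_clZ (g := f - ContinuousMap.const X (f x)) ?_ _ h
    (subset_closure ⟨x, by simp [zeroSet], rfl⟩)
  rintro y ⟨h1, h2⟩
  simp [h1] at h2
  exact hx' h2

lemma zeroSet_subset_of_clZ_subset {f g : C(X, ℝ)} (h : clZ f ⊆ clZ g) :
    zeroSet f ⊆ zeroSet g := fun x hx =>
  mem_zeroSet_of_unit_mem_clZ (h (subset_closure ⟨x, hx, rfl⟩))

lemma IsZIdeal.mem_of_zeroSet_subset {I : Ideal C(X, ℝ)} (hI : IsZIdeal I) {f g : C(X, ℝ)}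
    (hf : f ∈ I) (h : zeroSet f ⊆ zeroSet g) : g ∈ I := by
  refine hI g ⟨g * f, I.mul_mem_left g hf, ?_⟩
  ext x
  refine mul_eq_zero.trans ⟨fun hx => hx.elim id fun hx => h hx, Or.inl⟩

/-- An open set of `βX` whose trace on `X` lies in `Z(f)` is contained in `cl_{βX} Z(f)`. -/
lemma subset_clZ_of_isOpen {W : Set (StoneCech X)} (hW : IsOpen W) {f : C(X, ℝ)}
    (h : ∀ x, stoneCechUnit x ∈ W → f x = 0) : W ⊆ clZ f := by
  refine (denseRange_stoneCechUnit.open_subset_closure_inter hW).trans (closure_mono ?_)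
  rintro _ ⟨hy, x, rfl⟩
  exact ⟨x, h x hy, rfl⟩

/-- Compactness of `βX`: sums of squares make the sets `clZ h` directed downwards, so a
neighbourhood `clZ f` of their intersection contains a single `clZ h`. Then `zeroSet h ⊆ zeroSet f`.
-/
lemma oSet_hull_le (I : ZIdeal X) : oSet (hull I.1) ≤ I := by
  intro f hf
  rw [mem_oSet] at hf
  have : Nonempty I.1 := ⟨0⟩
  obtain ⟨h, hh⟩ := exists_subset_nhds_of_isCompact' (V := fun h : I.1 => clZ h.1)
    (fun a b => by
      refine ⟨⟨a.1 * a.1 + b.1 * b.1, I.1.add_mem (I.1.mul_mem_left _ a.2)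
        (I.1.mul_mem_left _ b.2)⟩, clZ_mono ?_, clZ_mono ?_⟩ <;> rw [zeroSet_sq_add_sq]
      exacts [Set.inter_subset_left, Set.inter_subset_right])
    (fun _ => isClosed_closure.isCompact) (fun _ => isClosed_closure) hf
  exact I.2.mem_of_zeroSet_subset h.2 (zeroSet_subset_of_clZ_subset hh)

lemma le_mSet_hull (I : ZIdeal X) : I ≤ mSet (hull I.1) := fun _ hf =>
  mem_mSet.2 fun _ hp => hull_subset hf hp

/-- A point outside a closed set `K` of `βX` is separated from `K` by a member of `O^K`. -/
lemma exists_mem_oSet_of_notMem {K : Set (StoneCech X)} (hK : IsClosed K) {p : StoneCech X}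
    (hp : p ∉ K) : ∃ g ∈ (oSet K).1,
      ∀ h : C(X, ℝ), (∀ x ∈ zeroSet h, |g x| < 1 / 2) → p ∉ clZ h := by
  obtain ⟨φ, hφ0, hφ1, -⟩ := exists_continuous_zero_one_of_isClosed hK
    (isClosed_singleton (x := p)) (Set.disjoint_singleton_right.2 hp)
  have hφp : φ p = 1 := hφ1 rfl
  -- The cut at 1/4 makes `g` vanish near `K`, while `|g| < 1/2` forces `φ ≤ 3/4 < 1 = φ p`.
  let g : C(X, ℝ) := ⟨fun x => max (φ (stoneCechUnit x) - 1 / 4) 0, by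
    have := continuous_stoneCechUnit (α := X)
    fun_prop⟩
  refine ⟨g, mem_oSet.2 fun q hq => ?_, fun h hh hph => ?_⟩
  · have hW : IsOpen {y : StoneCech X | φ y < 1 / 4} := isOpen_lt (by fun_prop) (by fun_prop)
    have hqW : φ q < 1 / 4 := by
      rw [show φ q = 0 from hφ0 hq]
      norm_num
    refine Filter.mem_of_superset (hW.mem_nhds hqW) (subset_clZ_of_isOpen hW fun x hx => ?_)
    have hx' : φ (stoneCechUnit x) < 1 / 4 := hx
    exact max_eq_right (by linarith)
  · have hsub : clZ h ⊆ {y : StoneCech X | φ y ≤ 3 / 4} := by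
      refine closure_minimal ?_ (isClosed_le (by fun_prop) (by fun_prop))
      rintro _ ⟨x, hx, rfl⟩
      have h1 : φ (stoneCechUnit x) - 1 / 4 ≤ g x := le_max_left _ _
      have h2 := (abs_lt.1 (hh x hx)).2
      change φ (stoneCechUnit x) ≤ 3 / 4
      linarith
    have : φ p ≤ 3 / 4 := hsub hph
    rw [hφp] at this
    norm_num at this

lemma hull_oSet_subset {K : Set (StoneCech X)} (hK : IsClosed K) : hull (oSet K).1 ⊆ K := by
  intro p hp
  by_contra hpK
  obtain ⟨g, hg, h⟩ := exists_mem_oSet_of_notMem hK hpK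
  refine h g (fun x hx => ?_) (hull_subset hg hp)
  rw [show g x = 0 from hx]
  norm_num

lemma closure_subset_hull_mSet (A : Set (StoneCech X)) : closure A ⊆ hull (mSet A).1 :=
  closure_minimal (fun p hp => Set.mem_iInter.2 fun h => mem_mSet.1 h.2 p hp) (isClosed_hull _)

lemma oSet_closure_le_mSet (A : Set (StoneCech X)) : oSet (closure A) ≤ mSet A := fun _ hf =>
  mem_mSet.2 fun p hp => mem_of_mem_nhds (mem_oSet.1 hf p (subset_closure hp))

lemma hull_mSet (A : Set (StoneCech X)) : hull (mSet A).1 = closure A :=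
  ((hull_anti (oSet_closure_le_mSet A)).trans (hull_oSet_subset isClosed_closure)).antisymm
    (closure_subset_hull_mSet A)

lemma hull_eq_closure_iff (I : ZIdeal X) (A : Set (StoneCech X)) :
    hull I.1 = closure A ↔ oSet (closure A) ≤ I ∧ I ≤ mSet A := by
  refine ⟨fun h => ?_, fun ⟨h1, h2⟩ => ?_⟩
  · rw [← h]
    refine ⟨oSet_hull_le I, fun f hf => mem_mSet.2 fun p hp => hull_subset hf ?_⟩
    exact h ▸ subset_closure hp
  · exact ((hull_anti h1).trans (hull_oSet_subset isClosed_closure)).antisymm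
      ((closure_subset_hull_mSet A).trans (hull_anti h2))

/-! ### The hull determines both topologies -/

/-- A function positive on some `Z ∈ Z[I]` is positive on the zero set of a member of
`O^{hull I}`. -/
lemma exists_mem_oSet_hull_pos {I : Ideal C(X, ℝ)} {Z : Set X} (hZ : Z ∈ zeroSets I)
    {w : C(X, ℝ)} (hw : ∀ x ∈ Z, 0 < w x) :
    ∃ g ∈ (oSet (hull I)).1, ∀ x ∈ zeroSet g, 0 < w x := by
  obtain ⟨h, hh, rfl⟩ := hZ
  have hpos : ∀ x, 0 < |h x| + max (w x) 0 := by
    intro x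
    by_cases h0 : h x = 0
    · exact add_pos_of_nonneg_of_pos (abs_nonneg _) (lt_max_of_lt_left (hw x h0))
    · exact add_pos_of_pos_of_nonneg (abs_pos.2 h0) (le_max_right _ _)
  -- `q` is 0 on `zeroSet h` and 1 wherever `w ≤ 0`; cutting it at 1/2 gives a function vanishing
  -- near the hull whose zeros avoid `w ≤ 0`.
  let q : X → unitInterval := fun x => ⟨|h x| / (|h x| + max (w x) 0), by
    have := hpos x
    refine ⟨by positivity, ?_⟩
    rw [div_le_one this]
    exact le_add_of_nonneg_right (le_max_right _ _)⟩
  have hq : Continuous q := by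
    refine Continuous.subtype_mk ?_ _
    exact Continuous.div (by fun_prop) (by fun_prop) fun x => (hpos x).ne'
  obtain ⟨E, hE, hEq⟩ : ∃ E : StoneCech X → ℝ, Continuous E ∧ ∀ x, E (stoneCechUnit x) = q x :=
    ⟨Subtype.val ∘ stoneCechExtend hq, continuous_subtype_val.comp (continuous_stoneCechExtend hq),
      fun x => congrArg Subtype.val (stoneCechExtend_stoneCechUnit hq x)⟩
  let g : C(X, ℝ) := ⟨fun x => max ((q x : ℝ) - 1 / 2) 0, by fun_prop⟩
  refine ⟨g, mem_oSet.2 fun p hp => ?_, fun x hx => ?_⟩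
  · have hsub : clZ h ⊆ {y | E y = 0} := by
      refine closure_minimal ?_ (isClosed_eq hE continuous_const)
      rintro _ ⟨x, hx, rfl⟩
      have hx' : h x = 0 := hx
      simp [hEq, q, hx']
    have hp0 : E p = 0 := hsub (hull_subset hh hp)
    have hW : IsOpen {y | E y < 1 / 2} := isOpen_lt hE continuous_const
    have hpW : E p < 1 / 2 := by
      rw [hp0]
      norm_num
    refine Filter.mem_of_superset (hW.mem_nhds hpW) (subset_clZ_of_isOpen hW fun x hx => ?_)
    have hx' : E (stoneCechUnit x) < 1 / 2 := hx
    rw [hEq] at hx'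
    exact max_eq_right (by linarith)
  · by_contra hwx
    have hm : max (w x) 0 = 0 := max_eq_right (not_lt.1 hwx)
    have hp := hpos x
    have hqx : (q x : ℝ) = 1 := by
      simp only [q, hm, add_zero] at hp ⊢
      exact div_self hp.ne'
    have hgx : max ((q x : ℝ) - 1 / 2) 0 = 0 := hx
    have := le_max_left ((q x : ℝ) - 1 / 2) 0
    rw [hgx, hqx] at this
    norm_num at this

lemma exists_mem_zeroSets_pos {I : Ideal C(X, ℝ)} {J : ZIdeal X} (hIJ : hull J.1 = hull I)
    {Z : Set X} (hZ : Z ∈ zeroSets I) {w : C(X, ℝ)} (hw : ∀ x ∈ Z, 0 < w x) :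
    ∃ Y ∈ zeroSets J.1, ∀ x ∈ Y, 0 < w x := by
  obtain ⟨g, hg, hgw⟩ := exists_mem_oSet_hull_pos hZ hw
  rw [← hIJ] at hg
  exact ⟨_, ⟨g, oSet_hull_le J hg, rfl⟩, hgw⟩

lemma mBasic_subset_of_hull_eq {I J : ZIdeal X} (h : hull J.1 = hull I.1) (f u : C(X, ℝ)) :
    mBasic I.1 f u ⊆ mBasic J.1 f u := by
  rintro g ⟨Z, hZ, hg⟩
  let w : C(X, ℝ) := ⟨fun x => u x - |f x - g x|, by fun_prop⟩
  obtain ⟨Y, hY, hw⟩ := exists_mem_zeroSets_pos h hZ (w := w) fun x hx => sub_pos.2 (hg x hx)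
  exact ⟨Y, hY, fun x hx => sub_pos.1 (hw x hx)⟩

/-- A real `δ` strictly between the supremum and `ε` removes `EReal`. On empty `Z` the supremum is
`⊥`, so `δ` is not required to be positive. -/
lemma mem_uBasic_iff {I : Ideal C(X, ℝ)} {f g : C(X, ℝ)} {ε : ℝ} :
    g ∈ uBasic I f ε ↔ ∃ Z ∈ zeroSets I, ∃ δ < ε, ∀ x ∈ Z, |f x - g x| < δ := by
  refine exists_congr fun Z => and_congr_right fun _ => ⟨fun h => ?_, ?_⟩
  · obtain ⟨δ, h1, h2⟩ := EReal.lt_iff_exists_real_btwn.1 h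
    refine ⟨δ, EReal.coe_lt_coe_iff.1 h2, fun x hx => EReal.coe_lt_coe_iff.1 ?_⟩
    exact (le_iSup₂ (f := fun x (_ : x ∈ Z) => ((|f x - g x| : ℝ) : EReal)) x hx).trans_lt h1
  · rintro ⟨δ, hδ, h⟩
    exact (iSup₂_le fun x hx => EReal.coe_le_coe_iff.2 (h x hx).le).trans_lt
      (EReal.coe_lt_coe_iff.2 hδ)

lemma uBasic_subset_of_hull_eq {I J : ZIdeal X} (h : hull J.1 = hull I.1) (f : C(X, ℝ)) (ε : ℝ) :
    uBasic I.1 f ε ⊆ uBasic J.1 f ε := by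
  intro g hg
  obtain ⟨Z, hZ, δ, hδ, hg⟩ := mem_uBasic_iff.1 hg
  let w : C(X, ℝ) := ⟨fun x => δ - |f x - g x|, by fun_prop⟩
  obtain ⟨Y, hY, hw⟩ := exists_mem_zeroSets_pos h hZ (w := w) fun x hx => sub_pos.2 (hg x hx)
  exact mem_uBasic_iff.2 ⟨Y, hY, δ, hδ, fun x hx => sub_pos.1 (hw x hx)⟩

lemma uTopology_eq_of_hull_eq {I J : ZIdeal X} (h : hull I.1 = hull J.1) :
    uTopology I.1 = uTopology J.1 := by
  have key : ∀ f ε, uBasic I.1 f ε = uBasic J.1 f ε := fun f ε =>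
    (uBasic_subset_of_hull_eq h.symm f ε).antisymm (uBasic_subset_of_hull_eq h f ε)
  simp only [uTopology, key]

lemma mTopology_eq_of_hull_eq {I J : ZIdeal X} (h : hull I.1 = hull J.1) :
    mTopology I.1 = mTopology J.1 := by
  have key : ∀ f u, mBasic I.1 f u = mBasic J.1 f u := fun f u =>
    (mBasic_subset_of_hull_eq h.symm f u).antisymm (mBasic_subset_of_hull_eq h f u)
  have hpos : ∀ u : C(X, ℝ),
      (∃ Z ∈ zeroSets I.1, ∀ x ∈ Z, 0 < u x) ↔ ∃ Z ∈ zeroSets J.1, ∀ x ∈ Z, 0 < u x := fun u =>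
    ⟨fun ⟨_, hZ, hu⟩ => exists_mem_zeroSets_pos h.symm hZ hu,
      fun ⟨_, hZ, hu⟩ => exists_mem_zeroSets_pos h hZ hu⟩
  simp only [mTopology, key, hpos]

/-! ### Each topology determines the hull -/

lemma zeroSet_sub_mem {I : Ideal C(X, ℝ)} {f g : C(X, ℝ)} (h : f - g ∈ I) :
    {x | f x = g x} ∈ zeroSets I :=
  ⟨_, h, by ext x; exact sub_eq_zero⟩

/-- Induction on generated open sets, which avoids checking that the generators form a base. -/
lemma mem_of_isOpen_generateFrom {α : Type*} {B : Set (Set α)} {a b : α}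
    (h : ∀ S ∈ B, a ∈ S → b ∈ S) {T : Set α} (hT : IsOpen[TopologicalSpace.generateFrom B] T)
    (ha : a ∈ T) : b ∈ T := by
  induction hT with
  | basic S hS => exact h S hS ha
  | univ => trivial
  | inter S T _ _ h1 h2 => exact ⟨h1 ha.1, h2 ha.2⟩
  | sUnion S _ ih =>
    obtain ⟨T, hT, haT⟩ := ha
    exact ⟨T, hT, ih T hT haT⟩

lemma mem_of_isOpen_uTopology {I : Ideal C(X, ℝ)} {f g : C(X, ℝ)} (hfg : f - g ∈ I)
    {T : Set C(X, ℝ)} (hT : IsOpen[uTopology I] T) (hf : f ∈ T) : g ∈ T := by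
  refine mem_of_isOpen_generateFrom ?_ hT hf
  rintro _ ⟨k, ε, -, rfl⟩ hk
  obtain ⟨Z, hZ, δ, hδ, h⟩ := mem_uBasic_iff.1 hk
  refine mem_uBasic_iff.2 ⟨_, inter_mem_zeroSets hZ (zeroSet_sub_mem hfg), δ, hδ, fun x hx => ?_⟩
  rw [← show f x = g x from hx.2]
  exact h x hx.1

lemma mem_of_isOpen_mTopology {I : Ideal C(X, ℝ)} {f g : C(X, ℝ)} (hfg : f - g ∈ I)
    {T : Set C(X, ℝ)} (hT : IsOpen[mTopology I] T) (hf : f ∈ T) : g ∈ T := by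
  refine mem_of_isOpen_generateFrom ?_ hT hf
  rintro _ ⟨k, u, -, rfl⟩ ⟨Z, hZ, h⟩
  refine ⟨_, inter_mem_zeroSets hZ (zeroSet_sub_mem hfg), fun x hx => ?_⟩
  rw [← show f x = g x from hx.2]
  exact h x hx.1

/-- If every member of `I` is smaller than `1/2` on some `Z ∈ Z[J]`, then the hull of `J` is
contained in that of `I`. -/
lemma hull_subset_hull_of_forall_lt {I : ZIdeal X} {J : Ideal C(X, ℝ)}
    (h : ∀ g ∈ I.1, ∃ Z ∈ zeroSets J, ∀ x ∈ Z, |g x| < 1 / 2) : hull J ⊆ hull I.1 := by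
  intro p hp
  by_contra hpI
  obtain ⟨g, hg, hgp⟩ := exists_mem_oSet_of_notMem (isClosed_hull I.1) hpI
  obtain ⟨_, ⟨k, hk, rfl⟩, hkg⟩ := h g (oSet_hull_le I hg)
  exact hgp k hkg (hull_subset hk hp)

lemma univ_mem_zeroSets (I : Ideal C(X, ℝ)) : Set.univ ∈ zeroSets I :=
  ⟨0, I.zero_mem, by ext; simp [zeroSet]⟩

lemma hull_subset_of_uTopology_eq {I J : ZIdeal X} (h : uTopology I.1 = uTopology J.1) :
    hull J.1 ⊆ hull I.1 := by
  refine hull_subset_hull_of_forall_lt fun g hg => ?_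
  have hopen : IsOpen[uTopology I.1] (uBasic J.1 0 (1 / 2)) :=
    h ▸ TopologicalSpace.isOpen_generateFrom_of_mem ⟨0, 1 / 2, by norm_num, rfl⟩
  have h0 : (0 : C(X, ℝ)) ∈ uBasic J.1 0 (1 / 2) :=
    mem_uBasic_iff.2 ⟨_, univ_mem_zeroSets _, 1 / 4, by norm_num, fun x _ => by simp⟩
  -- Since `0 - g ∈ I`, the `I`-open set containing 0 also contains `g`.
  obtain ⟨Z, hZ, δ, hδ, hgZ⟩ := mem_uBasic_iff.1
    (mem_of_isOpen_uTopology (g := g) (by simpa using hg) hopen h0)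
  exact ⟨Z, hZ, fun x hx => by simpa using (hgZ x hx).trans hδ⟩

lemma hull_subset_of_mTopology_eq {I J : ZIdeal X} (h : mTopology I.1 = mTopology J.1) :
    hull J.1 ⊆ hull I.1 := by
  refine hull_subset_hull_of_forall_lt fun g hg => ?_
  let u : C(X, ℝ) := ContinuousMap.const X (1 / 2)
  have hopen : IsOpen[mTopology I.1] (mBasic J.1 0 u) :=
    h ▸ TopologicalSpace.isOpen_generateFrom_of_mem
      ⟨0, u, ⟨_, univ_mem_zeroSets _, fun x _ => by simp [u]⟩, rfl⟩
  have h0 : (0 : C(X, ℝ)) ∈ mBasic J.1 0 u :=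
    ⟨_, univ_mem_zeroSets _, fun x _ => by simp [u]⟩
  obtain ⟨Z, hZ, hgZ⟩ := mem_of_isOpen_mTopology (g := g) (by simpa using hg) hopen h0
  exact ⟨Z, hZ, fun x hx => by simpa [u] using hgZ x hx⟩

/-! ### Equivalence classes as order intervals -/

lemma uTopology_eq_iff {I J : ZIdeal X} :
    uTopology I.1 = uTopology J.1 ↔ hull I.1 = hull J.1 :=
  ⟨fun h => (hull_subset_of_uTopology_eq h.symm).antisymm (hull_subset_of_uTopology_eq h),
    uTopology_eq_of_hull_eq⟩

lemma mTopology_eq_iff {I J : ZIdeal X} :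
    mTopology I.1 = mTopology J.1 ↔ hull I.1 = hull J.1 :=
  ⟨fun h => (hull_subset_of_mTopology_eq h.symm).antisymm (hull_subset_of_mTopology_eq h),
    mTopology_eq_of_hull_eq⟩

lemma uClass_eq (I : ZIdeal X) : uClass I = {J : ZIdeal X | hull I.1 = hull J.1} :=
  Set.ext fun _ => uTopology_eq_iff

lemma mClass_eq (I : ZIdeal X) : mClass I = {J : ZIdeal X | hull I.1 = hull J.1} :=
  Set.ext fun _ => mTopology_eq_iff

lemma mClass_eq_uClass (I : ZIdeal X) : mClass I = uClass I :=
  (mClass_eq I).trans (uClass_eq I).symm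

lemma uClass_mSet (A : Set (StoneCech X)) :
    uClass (mSet A) = {I : ZIdeal X | oSet (closure A) ≤ I ∧ I ≤ mSet A} := by
  rw [uClass_eq]
  ext I
  rw [Set.mem_ofPred_eq, hull_mSet, eq_comm]
  exact hull_eq_closure_iff I A

lemma uClass_eq_Icc (I : ZIdeal X) :
    uClass I = Set.Icc (oSet (hull I.1)) (mSet (hull I.1)) := by
  have h : uClass I = uClass (mSet (hull I.1)) := by
    rw [uClass_eq, uClass_eq, hull_mSet, (isClosed_hull I.1).closure_eq]
  rw [h, uClass_mSet, (isClosed_hull I.1).closure_eq]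
  rfl

lemma exists_isLeast_isGreatest_uClass (I : ZIdeal X) :
    (∃ S, IsLeast (uClass I) S) ∧ ∃ L, IsGreatest (uClass I) L := by
  rw [uClass_eq_Icc]
  have h := (oSet_hull_le I).trans (le_mSet_hull I)
  exact ⟨⟨_, isLeast_Icc h⟩, ⟨_, isGreatest_Icc h⟩⟩

end ZIdealTop

open ZIdealTop
theorem mainTheorem6 (X : Type*) [TopologicalSpace X] [T35Space X] :
    (∀ A : Set (StoneCech X),
      uClass (mSet A) = {I : ZIdeal X | oSet (closure A) ≤ I ∧ I ≤ mSet A} ∧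
      mClass (mSet A) = {I : ZIdeal X | oSet (closure A) ≤ I ∧ I ≤ mSet A}) ∧
    (∀ I : ZIdeal X, (∃ S, IsLeast (uClass I) S) ∧ (∃ L, IsGreatest (uClass I) L)) ∧
    (∀ I : ZIdeal X, (∃ S, IsLeast (mClass I) S) ∧ (∃ L, IsGreatest (mClass I) L)) ∧
    (∀ I : ZIdeal X, uClass I = mClass I) ∧
    uSetoid X = mSetoid X := by
  refine ⟨fun A => ⟨uClass_mSet A, (mClass_eq_uClass _).trans (uClass_mSet A)⟩,
    exists_isLeast_isGreatest_uClass, fun I => ?_, fun I => (mClass_eq_uClass I).symm,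
    Setoid.ext fun I J => uTopology_eq_iff.trans mTopology_eq_iff.symm⟩
  rw [mClass_eq_uClass]
  exact exists_isLeast_isGreatest_uClass I
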